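/- For a second countable locally compact Hausdorff space $X$ with Borel $\sigma$-algebra $\mathcal B(X)$, let $\mathscr P(X)$ be the space of Borel probability measures on $X$, with the $\sigma$-algebra generated by the evaluations $\eta\mapsto\eta A$, $A\in\mathcal B(X)$ (equivalently, the Borel $\sigma$-algebra of the vague topology). For $\boldsymbol\alpha\in(0,\infty)^k$, $k\ge 1$, let $\mathrm{Dir}_{\boldsymbol\alpha}$ be the Dirichlet distribution on the standard simplex $\Delta^{k-1}=\{y\in\mathbb R^k: y\ge 0,\ y_1+\dots+y_k=1\}$, i.e. the law of $(z_1,\dots,z_{k-1},z_k)$ with $z_k=1-z_1-\dots-z_{k-1}$, where $(z_1,\dots,z_{k-1})$ has Lebesgue density $\frac{\Gamma(\alpha_1+\dots+\alpha_k)}{\Gamma(\alpha_1)\cdots\Gamma(\alpha_k)}\prod_{i=1}^k z_i^{\alpha_i-1}$ on $\{z\in\mathbb R^{k-1}: z\ge0,\ z_1+\dots+z_{k-1}\le1\}$ (for $k=1$, the Dirac mass at $1$). For a non-zero finite Borel measure $\nu$ on $X$, the Dirichlet–Ferguson measure $\mathcal D_\nu$ with intensity $\nu$ is the unique probability measure on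 $\mathscr P(X)$ such that (a) for every $k\ge1$ and every measurable partition $(X_1,\dots,X_k)$ of $X$ with $\nu X_i>0$ for all $i$, the law of $\eta\mapsto(\eta X_1,\dots,\eta X_k)$ under $\mathcal D_\nu$ is $\mathrm{Dir}_{(\nu X_1,\dots,\nu X_k)}$; (b) for every $N\in\mathcal B(X)$ with $\nu N=0$ one has $\eta N=0$ for $\mathcal D_\nu$-a.e. $\eta$. **Theorem (Mapping theorem for Dirichlet–Ferguson measures).** Let $X$, $X'$ be second countable locally compact Hausdorff spaces with their Borel $\sigma$-algebras, $\nu$ a non-zero finite non-negative Borel measure on $X$, and $f\colon X\to X'$ a measurable map. Write $f_\sharp$ for the push-forward of measures along $f$, which in particular defines a map $f_\sharp\colon\mathscr P(X)\to\mathscr P(X')$, $\eta\mapsto f_\sharp\eta=\eta\circ f^{-1}$. Then the Dirichlet–Ferguson measures $\mathcal D_\nu$ and $\mathcal D_{f_\sharp\nu}$ exist and are unique, and $$(f_\sharp)_\sharp\,\mathcal D_\nu=\mathcal D_{f_\sharp\nu}.$$ -/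

import Mathlib

open MeasureTheory

noncomputable section

namespace DirichletFerguson

/-! ### The Dirichlet distribution on the standard simplex -/

/-- The corner simplex `{z ∈ ℝⁿ | z ≥ 0, z₁ + ⋯ + zₙ ≤ 1}`. -/
def cornerSimplex (n : ℕ) : Set (Fin n → ℝ) :=
  {z | (∀ i, 0 ≤ z i) ∧ ∑ i, z i ≤ 1}

/-- The parametrization `z ↦ (z₁, …, zₙ, 1 - (z₁ + ⋯ + zₙ))` of the hyperplane
`y₁ + ⋯ + yₙ₊₁ = 1` in `ℝⁿ⁺¹`. It maps the corner simplex onto the standard simplex. -/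
def fillSimplex {n : ℕ} (z : Fin n → ℝ) : Fin (n + 1) → ℝ :=
  Fin.snoc (α := fun _ => ℝ) z (1 - ∑ i, z i)

/-- The multivariate Beta function `Γ(α₁) ⋯ Γ(αₖ) / Γ(α₁ + ⋯ + αₖ)`. -/
def multiBeta {k : ℕ} (α : Fin k → ℝ) : ℝ :=
  (∏ i, Real.Gamma (α i)) / Real.Gamma (∑ i, α i)

/-- The density `y ↦ y₁ ^ (α₁ - 1) ⋯ yₖ ^ (αₖ - 1) / B(α)` of the Dirichlet distribution. -/
def dirichletDensity {k : ℕ} (α : Fin k → ℝ) (y : Fin k → ℝ) : ℝ :=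
  (∏ i, y i ^ (α i - 1)) / multiBeta α

/-- The Dirichlet distribution with parameter `α ∈ ℝᵏ`, `k = n + 1` (it is used for `α > 0`),
as a measure on `ℝᵏ` concentrated on the standard simplex: the image under `fillSimplex` of the
measure on the corner simplex of `ℝⁿ` with Lebesgue density
`z ↦ z₁ ^ (α₁ - 1) ⋯ zₖ ^ (αₖ - 1) / B(α)`, where `zₖ = 1 - (z₁ + ⋯ + zₙ)`.
For `k = 1` it is the Dirac mass at the point `1`. -/
def dirichlet {n : ℕ} (α : Fin (n + 1) → ℝ) : Measure (Fin (n + 1) → ℝ) :=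
  (((volume : Measure (Fin n → ℝ)).restrict (cornerSimplex n)).withDensity
    (fun z => ENNReal.ofReal (dirichletDensity α (fillSimplex z)))).map fillSimplex

/-! ### The Dirichlet–Ferguson measure -/

/-- `(A₁, …, Aₖ)` is a measurable partition of `X` into sets of positive `ν`-measure. -/
structure IsNontrivialPartition {X : Type*} [MeasurableSpace X] (ν : Measure X) {k : ℕ}
    (A : Fin k → Set X) : Prop where
  measurableSet : ∀ i, MeasurableSet (A i)
  pos : ∀ i, 0 < ν (A i)
  disjoint : ∀ i j, i ≠ j → Disjoint (A i) (A j)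
  iUnion_eq : ⋃ i, A i = Set.univ

/-- The evaluation `η ↦ (η A₁, …, η Aₖ)` on probability measures. -/
def evalPartition {X : Type*} [MeasurableSpace X] {k : ℕ} (A : Fin k → Set X)
    (η : ProbabilityMeasure X) : Fin k → ℝ :=
  fun i => (η : Measure X).real (A i)

/-- `D` is a Dirichlet–Ferguson measure with intensity `ν`, where `ν = β σ` with `β = ν X > 0` and
`σ` a probability: a random probability (probability measure on the space of probability measures,
with the `σ`-algebra generated by the evaluations `η ↦ η A`, which for a second countable locally
compact Hausdorff space is the Borel `σ`-algebra of the vague and of the narrow topology)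
under which `(η A₁, …, η Aₖ)` has, for every nontrivial partition, the Dirichlet distribution with
parameter `(ν A₁, …, ν Aₖ)`, and under which `ν`-negligible sets are almost surely
`η`-negligible (the usual convention that a cell with parameter zero receives no mass; this follows
from the first property unless all of `ν` sits at one point, where only the partition `(X)` is
nontrivial). -/
structure IsDirichletFerguson {X : Type*} [MeasurableSpace X] (ν : Measure X)
    (D : Measure (ProbabilityMeasure X)) : Prop where
  isProbabilityMeasure : IsProbabilityMeasure D
  map_evalPartition : ∀ (n : ℕ) (A : Fin (n + 1) → Set X), IsNontrivialPartition ν A →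
    D.map (evalPartition A) = dirichlet (fun i => ν.real (A i))
  null : ∀ N : Set X, MeasurableSet N → ν N = 0 →
    ∀ᵐ η : ProbabilityMeasure X ∂D, (η : Measure X) N = 0

open Classical in
/-- The Dirichlet–Ferguson measure `D_ν` with intensity `ν` (with value `0` if there were none). -/
def dirichletFerguson {X : Type*} [MeasurableSpace X] (ν : Measure X) :
    Measure (ProbabilityMeasure X) :=
  if h : ∃ D : Measure (ProbabilityMeasure X), IsDirichletFerguson ν D then h.choose else 0

/-- The push-forward `f_♯ : η ↦ η ∘ f⁻¹` of probability measures along a measurable map. -/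
def pushforward {X X' : Type*} [MeasurableSpace X] [MeasurableSpace X'] {f : X → X'}
    (hf : Measurable f) (η : ProbabilityMeasure X) : ProbabilityMeasure X' :=
  η.map hf.aemeasurable

end DirichletFerguson

end

/-! The mapping property is formal once `D_ν` is characterised. Preimages under `f` carry a
partition of `X'` to a partition of `X` with the same masses, and `f_♯ν`-null sets to `ν`-null sets,
so the image of `D_ν` satisfies both defining properties for `f_♯ν`
(`IsDirichletFerguson.map_pushforward`), and uniqueness identifies it. The work lies in existence
and uniqueness.

Existence is Sethuraman's stick breaking. With `β = ν X`, take i.i.d. pairs `(v, x)` of law `Beta(1,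
β) ⊗ ν/β` and let `η` have atoms at the points `x` with the stick lengths as masses. Separating the
first pair gives `η = v δ_x + (1 - v) η'` with `η'` an independent copy of `η`. The vector `Y` of
cell masses therefore solves `Y = v e_J + (1 - v) Y` in law, where `J` is the cell of `x`. The
Dirichlet law solves the same equation (`sum_lintegral_dirichlet_stick`), and the solution is unique
(`eq_of_perpetuity`).

Uniqueness: a law on probability measures is determined by the joint laws of finitely many
evaluations. Finitely many sets generate a finite partition; its null cells are removed by the
second defining property, and the evaluations are sums of the remaining cell masses. -/

noncomputable section

namespace DirichletFerguson

open ProbabilityTheory Set Filter Topology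
open scoped ENNReal

/-! ### The Dirichlet integral -/

/-- The function `t ↦ t ^ (a - 1)` on `[0, ∞)`, extended by zero. -/
def posPow (a t : ℝ) : ℝ≥0∞ :=
  (Ici (0 : ℝ)).indicator (fun t => ENNReal.ofReal (t ^ (a - 1))) t

lemma posPow_of_nonneg (a : ℝ) {t : ℝ} (ht : 0 ≤ t) :
    posPow a t = ENNReal.ofReal (t ^ (a - 1)) :=
  indicator_of_mem (s := Ici (0 : ℝ)) ht _

lemma posPow_of_neg (a : ℝ) {t : ℝ} (ht : t < 0) : posPow a t = 0 :=
  indicator_of_notMem (s := Ici (0 : ℝ)) (by simpa using ht) _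

@[fun_prop]
lemma measurable_posPow (a : ℝ) : Measurable (posPow a) := by
  have : Measurable fun t : ℝ => ENNReal.ofReal (t ^ (a - 1)) := by fun_prop
  exact this.indicator measurableSet_Ici

lemma posPow_mul (a : ℝ) {c : ℝ} (hc : 0 < c) (t : ℝ) :
    posPow a (c * t) = ENNReal.ofReal (c ^ (a - 1)) * posPow a t := by
  rcases le_or_gt 0 t with ht | ht
  · rw [posPow_of_nonneg a ht, posPow_of_nonneg a (by positivity), Real.mul_rpow hc.le ht,
      ENNReal.ofReal_mul (by positivity)]
  · rw [posPow_of_neg a ht, posPow_of_neg a (mul_neg_of_pos_of_neg hc ht), mul_zero]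

lemma lintegral_comp_smul {E : Type*} [NormedAddCommGroup E] [NormedSpace ℝ E]
    [MeasurableSpace E] [BorelSpace E] [FiniteDimensional ℝ E] (μ : Measure E)
    [μ.IsAddHaarMeasure] (g : E → ℝ≥0∞) {r : ℝ} (hr : 0 < r) :
    ∫⁻ z, g z ∂μ = ENNReal.ofReal (r ^ Module.finrank ℝ E) * ∫⁻ z, g (r • z) ∂μ := by
  have h : ∫⁻ z, g (r • z) ∂μ = ∫⁻ z, g z ∂(μ.map (fun z => r • z)) :=
    ((measurableEmbedding_const_smul₀ hr.ne').lintegral_map g).symm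
  rw [h, Measure.map_addHaar_smul μ hr.ne', lintegral_smul_measure, smul_eq_mul, ← mul_assoc,
    abs_of_pos (by positivity), ← ENNReal.ofReal_mul (by positivity),
    mul_inv_cancel₀ (by positivity), ENNReal.ofReal_one, one_mul]

/-- The endpoints are excluded because `betaPDF` vanishes there, while `0 ^ 0 = 1` makes the left
side nonzero at `u = 0` for `a = 1` and at `u = 1` for `b = 1`. -/
lemma posPow_mul_posPow_one_sub {a b : ℝ} (ha : 0 < a) (hb : 0 < b) {u : ℝ} (h0 : u ≠ 0)
    (h1 : u ≠ 1) :
    posPow a u * posPow b (1 - u) = ENNReal.ofReal (beta a b) * betaPDF a b u := by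
  have hB := beta_pos ha hb
  rcases lt_or_gt_of_ne h0 with h | h
  · rw [posPow_of_neg a h, betaPDF_eq_zero_of_nonpos h.le, zero_mul, mul_zero]
  rcases lt_or_gt_of_ne h1 with h' | h'
  · rw [betaPDF_of_pos_lt_one h h', posPow_of_nonneg a h.le, posPow_of_nonneg b (by linarith),
      ← ENNReal.ofReal_mul hB.le, ← ENNReal.ofReal_mul (by positivity)]
    congr 1
    field_simp
  · rw [posPow_of_neg b (by linarith), betaPDF_eq_zero_of_one_le h'.le, mul_zero, mul_zero]

/-- A convolution: for `t > 0` the substitution `z = t u` reduces it to the Beta integral. At `t =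
0` it fails when `a + b = 1`, again because `0 ^ 0 = 1`. -/
lemma lintegral_posPow_mul_posPow {a b : ℝ} (ha : 0 < a) (hb : 0 < b) {t : ℝ} (ht : t ≠ 0) :
    ∫⁻ z, posPow a z * posPow b (t - z) =
      ENNReal.ofReal (beta a b) * posPow (a + b) t := by
  rcases lt_or_gt_of_ne ht with h | h
  · rw [posPow_of_neg _ h, mul_zero]
    refine (lintegral_congr fun z => ?_).trans lintegral_zero
    rcases lt_or_ge z 0 with hz | hz
    · rw [posPow_of_neg _ hz, zero_mul]
    · rw [posPow_of_neg b (by linarith), mul_zero]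
  · rw [lintegral_comp_smul volume _ h]
    have key : ∀ᵐ z : ℝ, posPow a (t • z) * posPow b (t - t • z) =
        ENNReal.ofReal (t ^ (a - 1) * t ^ (b - 1) * beta a b) * betaPDF a b z := by
      filter_upwards [Measure.ae_ne volume (0 : ℝ), Measure.ae_ne volume (1 : ℝ)] with z h0 h1
      have : t - t • z = t * (1 - z) := by simp only [smul_eq_mul]; ring
      have hB := beta_pos ha hb
      rw [this, smul_eq_mul, posPow_mul a h, posPow_mul b h, ENNReal.ofReal_mul (by positivity),
        ENNReal.ofReal_mul (by positivity), mul_assoc _ _ (betaPDF a b z),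
        ← posPow_mul_posPow_one_sub ha hb h0 h1]
      ring
    rw [lintegral_congr_ae key, lintegral_const_mul _ (by unfold betaPDF; fun_prop),
      lintegral_betaPDF_eq_one ha hb, mul_one, posPow_of_nonneg _ h.le,
      ← ENNReal.ofReal_mul (by positivity), ← ENNReal.ofReal_mul (beta_pos ha hb).le]
    congr 1
    have : t ^ (a + b - 1) = t * (t ^ (a - 1) * t ^ (b - 1)) := by
      rw [show a + b - 1 = 1 + ((a - 1) + (b - 1)) by ring, Real.rpow_add h, Real.rpow_add h,
        Real.rpow_one]
    rw [this, Module.finrank_self, pow_one]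
    ring

lemma multiBeta_pos {n : ℕ} {α : Fin (n + 1) → ℝ} (hα : ∀ i, 0 < α i) : 0 < multiBeta α := by
  have hs : 0 < ∑ i, α i := Finset.sum_pos (fun i _ => hα i) Finset.univ_nonempty
  exact div_pos (Finset.prod_pos fun i _ => Real.Gamma_pos_of_pos (hα i))
    (Real.Gamma_pos_of_pos hs)

lemma multiBeta_succ {n : ℕ} {α : Fin (n + 2) → ℝ} (hα : ∀ i, 0 < α i) :
    multiBeta α = multiBeta (fun i : Fin (n + 1) => α i.succ) *
      beta (α 0) (∑ i : Fin (n + 1), α i.succ) := by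
  have hs : 0 < ∑ i : Fin (n + 1), α i.succ :=
    Finset.sum_pos (fun i _ => hα _) Finset.univ_nonempty
  have := (Real.Gamma_pos_of_pos hs).ne'
  rw [multiBeta, multiBeta, beta, Fin.prod_univ_succ, Fin.sum_univ_succ]
  field_simp

/-- Dirichlet's integral as an iterated convolution. Only `t = 1` is needed later, but fixing the
first coordinate `x` leaves the same integral with total `t - x`, so the induction needs general
`t`. The exceptional `x = t` is a null set. -/
lemma lintegral_prod_posPow {n : ℕ} {α : Fin (n + 1) → ℝ} (hα : ∀ i, 0 < α i) {t : ℝ}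
    (ht : t ≠ 0) :
    ∫⁻ z : Fin n → ℝ, (∏ i : Fin n, posPow (α i.castSucc) (z i)) *
        posPow (α (Fin.last n)) (t - ∑ i, z i) =
      ENNReal.ofReal (multiBeta α) * posPow (∑ i, α i) t := by
  induction n generalizing t with
  | zero =>
    have := (Real.Gamma_pos_of_pos (hα 0)).ne'
    rw [Measure.volume_pi_eq_dirac, lintegral_dirac]
    simp [multiBeta, this]
  | succ n ih =>
    have hs : 0 < ∑ i : Fin (n + 1), α i.succ :=
      Finset.sum_pos (fun i _ => hα _) Finset.univ_nonempty
    have hmp := (volume_preserving_piFinSuccAbove (fun _ : Fin (n + 1) => ℝ) 0).symm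
    rw [← hmp.lintegral_comp_emb (MeasurableEquiv.measurableEmbedding _)]
    simp only [MeasurableEquiv.piFinSuccAbove_symm_apply, Fin.insertNthEquiv, Equiv.coe_fn_mk,
      Fin.insertNth_zero, Fin.prod_univ_succ, Fin.sum_univ_succ (n := n), Fin.cons_zero,
      Fin.cons_succ, cast_eq]
    have hm : Measurable fun p : ℝ × (Fin n → ℝ) => posPow (α (Fin.castSucc 0)) p.1 *
        (∏ i : Fin n, posPow (α i.succ.castSucc) (p.2 i)) *
        posPow (α (Fin.last (n + 1))) (t - (p.1 + ∑ i, p.2 i)) := by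
      refine Measurable.mul (Measurable.mul (by fun_prop) ?_) (by fun_prop)
      exact Finset.measurable_fun_prod _ fun i _ => (measurable_posPow _).comp (by fun_prop)
    rw [Measure.volume_eq_prod, lintegral_prod _ hm.aemeasurable]
    have key : ∀ᵐ x : ℝ, (∫⁻ y : Fin n → ℝ, posPow (α (Fin.castSucc 0)) x *
          (∏ i : Fin n, posPow (α i.succ.castSucc) (y i)) *
          posPow (α (Fin.last (n + 1))) (t - (x + ∑ i, y i))) =
        ENNReal.ofReal (multiBeta fun i : Fin (n + 1) => α i.succ) *
          (posPow (α 0) x * posPow (∑ i : Fin (n + 1), α i.succ) (t - x)) := by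
      filter_upwards [Measure.ae_ne volume t] with x hx
      have h := ih (α := fun i => α i.succ) (fun i => hα _) (t := t - x)
        (sub_ne_zero.2 (Ne.symm hx))
      simp only [mul_assoc, ← sub_sub]
      rw [lintegral_const_mul _ (by fun_prop), Fin.castSucc_zero]
      simp only [Fin.succ_castSucc, Fin.succ_last] at h
      rw [h]
      ring
    refine (lintegral_congr_ae key).trans ?_
    rw [lintegral_const_mul _ (by fun_prop), lintegral_posPow_mul_posPow (hα 0) hs ht,
      multiBeta_succ hα, ENNReal.ofReal_mul (multiBeta_pos fun i => hα _).le, mul_assoc,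
      Fin.sum_univ_succ (n := n + 1)]

/-! ### The Dirichlet distribution -/

lemma fillSimplex_castSucc {n : ℕ} (z : Fin n → ℝ) (i : Fin n) :
    fillSimplex z i.castSucc = z i := by simp [fillSimplex]

lemma fillSimplex_last {n : ℕ} (z : Fin n → ℝ) :
    fillSimplex z (Fin.last n) = 1 - ∑ i, z i := by simp [fillSimplex]

lemma sum_fillSimplex {n : ℕ} (z : Fin n → ℝ) : ∑ i, fillSimplex z i = 1 := by
  simp [Fin.sum_univ_castSucc, fillSimplex_castSucc, fillSimplex_last]

@[fun_prop]
lemma measurable_fillSimplex {n : ℕ} : Measurable (fillSimplex (n := n)) := by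
  refine measurable_pi_lambda _ fun i => ?_
  refine Fin.lastCases ?_ (fun i => ?_) i
  · simp only [fillSimplex_last]; fun_prop
  · simp only [fillSimplex_castSucc]; fun_prop

lemma mem_cornerSimplex_iff {n : ℕ} {z : Fin n → ℝ} :
    z ∈ cornerSimplex n ↔ ∀ i, 0 ≤ fillSimplex z i := by
  simp [cornerSimplex, Fin.forall_fin_succ', fillSimplex_castSucc, fillSimplex_last]

lemma measurableSet_cornerSimplex (n : ℕ) : MeasurableSet (cornerSimplex n) := by
  have : cornerSimplex n = ⋂ i, (fun z => fillSimplex z i) ⁻¹' Ici 0 := by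
    ext z; simp [mem_cornerSimplex_iff]
  rw [this]
  exact MeasurableSet.iInter fun i =>
    (by fun_prop : Measurable fun z : Fin n → ℝ => fillSimplex z i) measurableSet_Ici

@[fun_prop]
lemma measurable_dirichletDensity {k : ℕ} (α : Fin k → ℝ) : Measurable (dirichletDensity α) := by
  unfold dirichletDensity
  fun_prop

/-- The zero extension in `posPow` encodes the simplex constraints, so integrals can run over all of
`ℝⁿ`, where translations and dilations act freely. -/
lemma indicator_dirichletDensity {n : ℕ} {α : Fin (n + 1) → ℝ} (hα : ∀ i, 0 < α i)
    (z : Fin n → ℝ) :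
    (cornerSimplex n).indicator
        (fun z => ENNReal.ofReal (dirichletDensity α (fillSimplex z))) z =
      ENNReal.ofReal (multiBeta α)⁻¹ * ∏ i, posPow (α i) (fillSimplex z i) := by
  by_cases hz : z ∈ cornerSimplex n
  · rw [indicator_of_mem hz]
    rw [mem_cornerSimplex_iff] at hz
    rw [dirichletDensity, div_eq_inv_mul, ENNReal.ofReal_mul (inv_pos.2 (multiBeta_pos hα)).le,
      ENNReal.ofReal_prod_of_nonneg fun i _ => Real.rpow_nonneg (hz i) _]
    congr 1
    exact Finset.prod_congr rfl fun i _ => (posPow_of_nonneg _ (hz i)).symm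
  · rw [indicator_of_notMem hz]
    rw [mem_cornerSimplex_iff] at hz
    push Not at hz
    obtain ⟨i, hi⟩ := hz
    rw [Finset.prod_eq_zero (Finset.mem_univ i) (posPow_of_neg _ hi), mul_zero]

lemma lintegral_dirichlet {n : ℕ} {α : Fin (n + 1) → ℝ} (hα : ∀ i, 0 < α i)
    {g : (Fin (n + 1) → ℝ) → ℝ≥0∞} (hg : Measurable g) :
    ∫⁻ y, g y ∂dirichlet α = ENNReal.ofReal (multiBeta α)⁻¹ *
      ∫⁻ z : Fin n → ℝ, g (fillSimplex z) * ∏ i, posPow (α i) (fillSimplex z i) := by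
  rw [dirichlet, lintegral_map hg measurable_fillSimplex,
    lintegral_withDensity_eq_lintegral_mul _ (by fun_prop) (by fun_prop),
    ← lintegral_indicator (measurableSet_cornerSimplex n), ← lintegral_const_mul _ (by fun_prop)]
  refine lintegral_congr fun z => ?_
  rw [show ((fun z => ENNReal.ofReal (dirichletDensity α (fillSimplex z))) * fun z =>
      g (fillSimplex z)) = fun z => ENNReal.ofReal (dirichletDensity α (fillSimplex z)) *
        g (fillSimplex z) from rfl, indicator_mul_left, indicator_dirichletDensity hα]
  ring

lemma isProbabilityMeasure_dirichlet {n : ℕ} {α : Fin (n + 1) → ℝ} (hα : ∀ i, 0 < α i) :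
    IsProbabilityMeasure (dirichlet α) := by
  constructor
  have hB := multiBeta_pos hα
  rw [← lintegral_one, lintegral_dirichlet hα (by fun_prop)]
  simp only [one_mul, Fin.prod_univ_castSucc, fillSimplex_castSucc, fillSimplex_last]
  rw [lintegral_prod_posPow hα one_ne_zero, posPow_of_nonneg _ zero_le_one, Real.one_rpow,
    ENNReal.ofReal_one, mul_one, ← ENNReal.ofReal_mul (by positivity), inv_mul_cancel₀ hB.ne',
    ENNReal.ofReal_one]

lemma ae_dirichlet_mem {n : ℕ} (α : Fin (n + 1) → ℝ) :
    ∀ᵐ y ∂dirichlet α, ∀ i, y i ∈ Icc (0 : ℝ) 1 := by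
  have hm : MeasurableSet {y : Fin (n + 1) → ℝ | ∀ i, y i ∈ Icc (0 : ℝ) 1} := by
    simp only [ofPred_forall]
    exact MeasurableSet.iInter fun i => measurable_pi_apply i measurableSet_Icc
  rw [dirichlet, ae_map_iff (by fun_prop) hm]
  refine (withDensity_absolutelyContinuous _ _).ae_le ?_
  filter_upwards [ae_restrict_mem (measurableSet_cornerSimplex n)] with z hz i
  rw [mem_cornerSimplex_iff] at hz
  refine ⟨hz i, ?_⟩
  rw [← sum_fillSimplex z]
  exact Finset.single_le_sum (fun j _ => hz j) (Finset.mem_univ i)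

/-! ### The Dirichlet distribution is invariant under a random stick breaking step -/

lemma beta_one {a : ℝ} (ha : 0 < a) : beta 1 a = a⁻¹ := by
  have := (Real.Gamma_pos_of_pos ha).ne'
  rw [beta, Real.Gamma_one, add_comm, Real.Gamma_add_one ha.ne']
  field_simp

/-- For `0 < s` this is `a ∫₀ˢ (s - v) ^ (a - 1) dv = s ^ a`; the bound `s ≤ 1` makes the cutoff at
`v = 1` harmless. The factor `s` split off on the right will be a coordinate of a point of the
simplex. -/
lemma lintegral_Ioo_posPow_sub {a s : ℝ} (ha : 0 < a) (hs : s ≤ 1) :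
    ENNReal.ofReal a * ∫⁻ v in Ioo (0 : ℝ) 1, posPow a (s - v) =
      ENNReal.ofReal s * posPow a s := by
  rcases le_or_gt s 0 with h | h
  · rw [ENNReal.ofReal_of_nonpos h, zero_mul, setLIntegral_congr_fun (g := fun _ => 0)
      measurableSet_Ioo fun v hv => posPow_of_neg a (by linarith [hv.1])]
    simp
  · have key : ∀ᵐ v : ℝ, (Ioo (0 : ℝ) 1).indicator (fun v => posPow a (s - v)) v =
        posPow 1 v * posPow a (s - v) := by
      filter_upwards [Measure.ae_ne volume (0 : ℝ), Measure.ae_ne volume (1 : ℝ)] with v h0 h1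
      rcases lt_or_gt_of_ne h0 with h0 | h0
      · rw [posPow_of_neg _ h0, zero_mul, indicator_of_notMem fun hv => h0.not_gt hv.1]
      rcases lt_or_gt_of_ne h1 with h1 | h1
      · rw [indicator_of_mem (show v ∈ Ioo (0 : ℝ) 1 from ⟨h0, h1⟩), posPow_of_nonneg 1 h0.le]
        simp
      · rw [indicator_of_notMem fun hv => h1.not_gt hv.2, posPow_of_neg a (by linarith), mul_zero]
    rw [← lintegral_indicator measurableSet_Ioo, lintegral_congr_ae key,
      lintegral_posPow_mul_posPow one_pos ha h.ne', beta_one ha, ← mul_assoc,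
      ← ENNReal.ofReal_mul ha.le, mul_inv_cancel₀ ha.ne', ENNReal.ofReal_one, one_mul,
      posPow_of_nonneg _ h.le, posPow_of_nonneg _ h.le, ← ENNReal.ofReal_mul h.le]
    congr 1
    rw [show 1 + a - 1 = 1 + (a - 1) by ring, Real.rpow_add h, Real.rpow_one]

lemma fillSimplex_smul_add {n : ℕ} (j : Fin (n + 1)) (v : ℝ) (z : Fin n → ℝ) :
    fillSimplex ((1 - v) • z + fun i => v * (Pi.single j 1 : Fin (n + 1) → ℝ) i.castSucc) =
      v • Pi.single j 1 + (1 - v) • fillSimplex z := by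
  have hsum : ∑ i : Fin n, (Pi.single j 1 : Fin (n + 1) → ℝ) i.castSucc =
      1 - (Pi.single j 1 : Fin (n + 1) → ℝ) (Fin.last n) := by
    have h : ∑ i, (Pi.single j 1 : Fin (n + 1) → ℝ) i = 1 := by simp
    rw [Fin.sum_univ_castSucc] at h
    linarith
  ext i
  refine Fin.lastCases ?_ (fun i => ?_) i
  · simp only [fillSimplex_last, Pi.add_apply, Pi.smul_apply, smul_eq_mul, Finset.sum_add_distrib,
      ← Finset.mul_sum, hsum]
    ring
  · simp only [fillSimplex_castSucc, Pi.add_apply, Pi.smul_apply, smul_eq_mul]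
    ring

/-- Substitute `x = (1 - v) z + v e_j` in the right-hand integral. The Jacobian `(1 - v) ^ n` and
the homogeneity factor `(1 - v) ^ (β - (n + 1))` combine to `(1 - v) ^ (β - 1)`, which is the
`Beta(1, β)` density up to the constant `β`. -/
lemma betaPDF_mul_lintegral_fillSimplex {n : ℕ} {α : Fin (n + 1) → ℝ} (hα : ∀ i, 0 < α i)
    (j : Fin (n + 1)) {v : ℝ} (hv : v ∈ Ioo (0 : ℝ) 1) {g : (Fin (n + 1) → ℝ) → ℝ≥0∞}
    (hg : Measurable g) :
    betaPDF 1 (∑ i, α i) v * ∫⁻ z : Fin n → ℝ,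
        g (v • Pi.single j 1 + (1 - v) • fillSimplex z) * ∏ i, posPow (α i) (fillSimplex z i) =
      ENNReal.ofReal (∑ i, α i) * ∫⁻ x : Fin n → ℝ,
        g (fillSimplex x) *
          ∏ i, posPow (α i) (fillSimplex x i - v * (Pi.single j 1 : Fin (n + 1) → ℝ) i) := by
  have hs : 0 < ∑ i, α i := Finset.sum_pos (fun i _ => hα i) Finset.univ_nonempty
  have hv' : 0 < 1 - v := by linarith [hv.2]
  set β := ∑ i, α i with hβ
  have hprod : ∀ z : Fin n → ℝ, ∏ i, posPow (α i) ((1 - v) * fillSimplex z i) =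
      ENNReal.ofReal ((1 - v) ^ (β - (n + 1))) * ∏ i, posPow (α i) (fillSimplex z i) := by
    intro z
    simp only [posPow_mul _ hv', Finset.prod_mul_distrib]
    rw [← ENNReal.ofReal_prod_of_nonneg fun i _ => by positivity, ← Real.rpow_sum_of_pos hv',
      Finset.sum_sub_distrib, ← hβ]
    simp
  have h1 : ∫⁻ x : Fin n → ℝ, g (fillSimplex x) *
      ∏ i, posPow (α i) (fillSimplex x i - v * (Pi.single j 1 : Fin (n + 1) → ℝ) i) =
      ENNReal.ofReal ((1 - v) ^ (β - 1)) * ∫⁻ z : Fin n → ℝ,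
        g (v • Pi.single j 1 + (1 - v) • fillSimplex z) *
          ∏ i, posPow (α i) (fillSimplex z i) := by
    rw [← lintegral_add_right_eq_self _
      (fun i : Fin n => v * (Pi.single j 1 : Fin (n + 1) → ℝ) i.castSucc),
      lintegral_comp_smul volume _ hv']
    simp only [fillSimplex_smul_add, Pi.add_apply, Pi.smul_apply, smul_eq_mul,
      add_sub_cancel_left, hprod]
    have h2 : ∀ z : Fin n → ℝ, g (v • Pi.single j 1 + (1 - v) • fillSimplex z) *
        (ENNReal.ofReal ((1 - v) ^ (β - (n + 1))) * ∏ i, posPow (α i) (fillSimplex z i)) =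
        ENNReal.ofReal ((1 - v) ^ (β - (n + 1))) *
          (g (v • Pi.single j 1 + (1 - v) • fillSimplex z) *
            ∏ i, posPow (α i) (fillSimplex z i)) := fun z => by ring
    simp only [h2]
    rw [lintegral_const_mul _ (by fun_prop), ← mul_assoc, ← ENNReal.ofReal_mul (by positivity)]
    congr 2
    rw [Module.finrank_fin_fun, ← Real.rpow_natCast, ← Real.rpow_add hv']
    congr 1
    ring
  rw [h1, betaPDF_of_pos_lt_one hv.1 hv.2, beta_one hs, ← mul_assoc,
    ← ENNReal.ofReal_mul hs.le]
  simp

/-- On the simplex the `j`-th term is `y j` times the full product, and the coordinates sum to `1`.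
Off it, a negative coordinate stays negative after subtracting `v > 0` or `0`, so both sides vanish.
-/
lemma sum_mul_lintegral_prod_posPow {n : ℕ} {α : Fin (n + 1) → ℝ} (hα : ∀ i, 0 < α i)
    {y : Fin (n + 1) → ℝ} (hy : ∑ i, y i = 1) :
    ∑ j, ENNReal.ofReal (α j) * ∫⁻ v in Ioo (0 : ℝ) 1,
        ∏ i, posPow (α i) (y i - v * (Pi.single j 1 : Fin (n + 1) → ℝ) i) =
      ∏ i, posPow (α i) (y i) := by
  have hsplit : ∀ j v, ∏ i, posPow (α i) (y i - v * (Pi.single j 1 : Fin (n + 1) → ℝ) i) =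
      (∏ i ∈ Finset.univ.erase j, posPow (α i) (y i)) * posPow (α j) (y j - v) := by
    intro j v
    rw [← Finset.prod_erase_mul _ _ (Finset.mem_univ j)]
    congr 1
    · refine Finset.prod_congr rfl fun i hi => ?_
      simp [Pi.single_eq_of_ne (Finset.ne_of_mem_erase hi)]
    · simp
  simp only [hsplit]
  by_cases h : ∀ i, 0 ≤ y i
  · have h1 : ∀ j, y j ≤ 1 := fun j => hy ▸ Finset.single_le_sum (fun i _ => h i)
      (Finset.mem_univ j)
    have : ∀ j, ENNReal.ofReal (α j) * ∫⁻ v in Ioo (0 : ℝ) 1,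
        (∏ i ∈ Finset.univ.erase j, posPow (α i) (y i)) * posPow (α j) (y j - v) =
        ENNReal.ofReal (y j) * ∏ i, posPow (α i) (y i) := by
      intro j
      rw [lintegral_const_mul _ (by fun_prop), mul_left_comm,
        lintegral_Ioo_posPow_sub (hα j) (h1 j), ← Finset.prod_erase_mul _ _ (Finset.mem_univ j)]
      ring
    rw [Finset.sum_congr rfl fun j _ => this j, ← Finset.sum_mul,
      ← ENNReal.ofReal_sum_of_nonneg fun i _ => h i, hy, ENNReal.ofReal_one, one_mul]
  · push Not at h
    obtain ⟨k, hk⟩ := h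
    rw [Finset.prod_eq_zero (Finset.mem_univ k) (posPow_of_neg _ hk)]
    refine Finset.sum_eq_zero fun j _ => ?_
    rw [setLIntegral_congr_fun (g := fun _ => 0) measurableSet_Ioo, lintegral_zero, mul_zero]
    intro v hv
    by_cases hjk : k = j
    · subst hjk
      simp only [posPow_of_neg (α k) (show y k - v < 0 by linarith [hv.1]), mul_zero]
    · have h0 : ∏ i ∈ Finset.univ.erase j, posPow (α i) (y i) = 0 :=
        Finset.prod_eq_zero (Finset.mem_erase.2 ⟨hjk, Finset.mem_univ k⟩) (posPow_of_neg (α k) hk)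
      simp only [h0, zero_mul]

lemma lintegral_betaMeasure {a b : ℝ} {g : ℝ → ℝ≥0∞} (hg : Measurable g) :
    ∫⁻ v, g v ∂betaMeasure a b = ∫⁻ v in Ioo (0 : ℝ) 1, betaPDF a b v * g v := by
  have hm : Measurable (betaPDF a b) := by unfold betaPDF; fun_prop
  rw [betaMeasure, lintegral_withDensity_eq_lintegral_mul _ hm hg,
    ← lintegral_indicator measurableSet_Ioo]
  refine lintegral_congr fun v => ?_
  by_cases hv : v ∈ Ioo (0 : ℝ) 1
  · rw [indicator_of_mem hv, Pi.mul_apply]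
  · rw [indicator_of_notMem hv, Pi.mul_apply]
    rcases le_or_gt v 0 with h | h
    · rw [betaPDF_eq_zero_of_nonpos h, zero_mul]
    · rw [betaPDF_eq_zero_of_one_le (not_lt.1 fun h' => hv ⟨h, h'⟩), zero_mul]

lemma lintegral_lintegral_mul_swap {S T : Type*} [MeasurableSpace S] [MeasurableSpace T]
    {μ : Measure S} {ν : Measure T} [SFinite μ] [SFinite ν] {w : T → ℝ≥0∞} {G : S × T → ℝ≥0∞}
    (hw : Measurable w) (hG : Measurable G) :
    ∫⁻ s, ∫⁻ t, w t * G (s, t) ∂ν ∂μ = ∫⁻ t, w t * ∫⁻ s, G (s, t) ∂μ ∂ν := by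
  rw [lintegral_lintegral_swap ((hw.comp measurable_snd).mul hG).aemeasurable]
  refine lintegral_congr fun t => ?_
  have h : Measurable fun s => G (s, t) := hG.comp measurable_prodMk_right
  rw [lintegral_const_mul _ h]

/-- Invariance of the Dirichlet law under `y ↦ v e_J + (1 - v) y` with `P(J = j) = α j / β`.
Changing variables at fixed `v` puts all dependence on `v` into the density; Tonelli then integrates
out `v` at a fixed point of the simplex. The `β` from the Beta density turns `α j / β` into `α j`.
-/
theorem sum_lintegral_dirichlet_stick {n : ℕ} {α : Fin (n + 1) → ℝ} (hα : ∀ i, 0 < α i)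
    {g : (Fin (n + 1) → ℝ) → ℝ≥0∞} (hg : Measurable g) :
    ∑ j, ENNReal.ofReal (α j / ∑ i, α i) * ∫⁻ v, ∫⁻ y,
        g (v • Pi.single j 1 + (1 - v) • y) ∂dirichlet α ∂betaMeasure 1 (∑ i, α i) =
      ∫⁻ y, g y ∂dirichlet α := by
  have hs : 0 < ∑ i, α i := Finset.sum_pos (fun i _ => hα i) Finset.univ_nonempty
  set β := ∑ i, α i with hβ
  set C := ENNReal.ofReal (multiBeta α)⁻¹ with hC
  have := isProbabilityMeasure_dirichlet hα
  have hF : ∀ j, Measurable fun p : ℝ × (Fin n → ℝ) =>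
      ∏ i, posPow (α i) (fillSimplex p.2 i - p.1 * (Pi.single j 1 : Fin (n + 1) → ℝ) i) := by
    intro j
    exact Finset.measurable_fun_prod _ fun i _ => (measurable_posPow _).comp (by fun_prop)
  have hgF : ∀ j, Measurable fun p : ℝ × (Fin n → ℝ) => g (fillSimplex p.2) *
      ∏ i, posPow (α i) (fillSimplex p.2 i - p.1 * (Pi.single j 1 : Fin (n + 1) → ℝ) i) :=
    fun j => (by fun_prop : Measurable fun p : ℝ × (Fin n → ℝ) => g (fillSimplex p.2)).mul (hF j)
  have hI : ∀ j, Measurable fun x : Fin n → ℝ => ∫⁻ v in Ioo (0 : ℝ) 1,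
      ∏ i, posPow (α i) (fillSimplex x i - v * (Pi.single j 1 : Fin (n + 1) → ℝ) i) :=
    fun j => (hF j).lintegral_prod_left'
  have hj : ∀ j, ENNReal.ofReal (α j / β) * ∫⁻ v, ∫⁻ y,
        g (v • Pi.single j 1 + (1 - v) • y) ∂dirichlet α ∂betaMeasure 1 β =
      C * ∫⁻ x : Fin n → ℝ, g (fillSimplex x) * (ENNReal.ofReal (α j) *
        ∫⁻ v in Ioo (0 : ℝ) 1, ∏ i, posPow (α i)
          (fillSimplex x i - v * (Pi.single j 1 : Fin (n + 1) → ℝ) i)) := by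
    intro j
    have hgm : Measurable fun p : ℝ × (Fin (n + 1) → ℝ) =>
        g (p.1 • Pi.single j 1 + (1 - p.1) • p.2) := by fun_prop
    rw [lintegral_betaMeasure hgm.lintegral_prod_right']
    have h1 : ∀ v ∈ Ioo (0 : ℝ) 1, betaPDF 1 β v * ∫⁻ y,
        g (v • Pi.single j 1 + (1 - v) • y) ∂dirichlet α =
        C * (ENNReal.ofReal β * ∫⁻ x : Fin n → ℝ, g (fillSimplex x) *
          ∏ i, posPow (α i) (fillSimplex x i - v * (Pi.single j 1 : Fin (n + 1) → ℝ) i)) := by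
      intro v hv
      rw [lintegral_dirichlet hα (by fun_prop), mul_left_comm, ← hC,
        betaPDF_mul_lintegral_fillSimplex hα j hv hg]
    have hm1 : Measurable fun v : ℝ => ∫⁻ x : Fin n → ℝ, g (fillSimplex x) *
        ∏ i, posPow (α i) (fillSimplex x i - v * (Pi.single j 1 : Fin (n + 1) → ℝ) i) :=
      (hgF j).lintegral_prod_right'
    have hswap := lintegral_lintegral_mul_swap (μ := volume.restrict (Ioo (0 : ℝ) 1))
      (ν := volume) (hg.comp measurable_fillSimplex) (hF j)
    have hm2 : Measurable fun x : Fin n → ℝ => g (fillSimplex x) * ∫⁻ v in Ioo (0 : ℝ) 1,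
        ∏ i, posPow (α i) (fillSimplex x i - v * (Pi.single j 1 : Fin (n + 1) → ℝ) i) :=
      (hg.comp measurable_fillSimplex).mul (hI j)
    simp only [Function.comp_apply] at hswap
    rw [setLIntegral_congr_fun measurableSet_Ioo h1, lintegral_const_mul _ (hm1.const_mul _),
      lintegral_const_mul _ hm1, hswap, mul_left_comm, ← mul_assoc (ENNReal.ofReal (α j / β)),
      ← ENNReal.ofReal_mul (by have := hα j; positivity), div_mul_cancel₀ _ hs.ne',
      ← lintegral_const_mul _ hm2]
    congr 1
    refine lintegral_congr fun x => ?_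
    rw [mul_left_comm]
  have hm3 : ∀ j, Measurable fun x : Fin n → ℝ => g (fillSimplex x) * (ENNReal.ofReal (α j) *
      ∫⁻ v in Ioo (0 : ℝ) 1, ∏ i, posPow (α i)
        (fillSimplex x i - v * (Pi.single j 1 : Fin (n + 1) → ℝ) i)) :=
    fun j => (hg.comp measurable_fillSimplex).mul ((hI j).const_mul _)
  rw [Finset.sum_congr rfl fun j _ => hj j, ← Finset.mul_sum, lintegral_dirichlet hα hg,
    ← lintegral_finsetSum _ fun j _ => hm3 j]
  congr 1
  refine lintegral_congr fun x => ?_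
  rw [← Finset.mul_sum, sum_mul_lintegral_prod_posPow hα (sum_fillSimplex x)]

/-! ### Uniqueness of the law of a perpetuity -/

section Perpetuity

variable {S E : Type*} [MeasurableSpace S] [NormedAddCommGroup E] [NormedSpace ℝ E]
  [MeasurableSpace E]
  {κ : Measure S} [IsProbabilityMeasure κ] {a : S → E} {r : S → ℝ}

lemma integrable_exp_dual [BorelSpace E] {T : Type*} [MeasurableSpace T] (μ : Measure T) [IsFiniteMeasure μ]
    (L : StrongDual ℝ E) {h : T → E} (hh : Measurable h) :
    Integrable (fun t => Complex.exp (L (h t) * Complex.I)) μ := by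
  refine Integrable.of_bound (C := 1) ?_ (ae_of_all _ fun t => ?_)
  · have : Measurable fun t => L (h t) := L.continuous.measurable.comp hh
    exact Measurable.aestronglyMeasurable (by fun_prop)
  · rw [Complex.norm_exp_ofReal_mul_I]

lemma integrable_perpetuity [BorelSpace E] [SecondCountableTopology E] (ha : Measurable a) (hr : Measurable r) (μ : Measure E)
    [IsProbabilityMeasure μ] (L : StrongDual ℝ E) :
    Integrable (fun p : S × E => Complex.exp (L (a p.1 + r p.1 • p.2) * Complex.I))
      (κ.prod μ) :=
  integrable_exp_dual _ L (by fun_prop)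

lemma integral_exp_add_smul (μ : Measure E) (L : StrongDual ℝ E) (x : E) (c : ℝ) :
    ∫ y, Complex.exp (L (x + c • y) * Complex.I) ∂μ =
      Complex.exp (L x * Complex.I) * charFunDual μ (c • L) := by
  rw [charFunDual_apply, ← integral_const_mul]
  congr 1
  ext y
  rw [← Complex.exp_add]
  congr 1
  simp
  ring

lemma charFunDual_perpetuity [BorelSpace E] [SecondCountableTopology E] (ha : Measurable a) (hr : Measurable r) {μ : Measure E}
    [IsProbabilityMeasure μ]
    (hμ : (κ.prod μ).map (fun p => a p.1 + r p.1 • p.2) = μ) (L : StrongDual ℝ E) :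
    charFunDual μ L =
      ∫ s, Complex.exp (L (a s) * Complex.I) * charFunDual μ (r s • L) ∂κ := by
  conv_lhs => rw [← hμ]
  rw [charFunDual_apply, integral_map (by fun_prop)
    (Continuous.aestronglyMeasurable (by fun_prop)),
    integral_prod _ (integrable_perpetuity ha hr μ L)]
  simp only [integral_exp_add_smul]

/-- From `|exp (i u) - 1| ≤ |u|`. This linear bound in `‖L‖` starts the contraction argument and is
where the first moment enters. -/
lemma norm_charFunDual_sub_one_le [BorelSpace E] {μ : Measure E} [IsProbabilityMeasure μ]
    (hμ : Integrable (fun y => ‖y‖) μ) (L : StrongDual ℝ E) :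
    ‖charFunDual μ L - 1‖ ≤ ‖L‖ * ∫ y, ‖y‖ ∂μ := by
  have h1 : charFunDual μ L - 1 = ∫ y, (Complex.exp (L y * Complex.I) - 1) ∂μ := by
    have := integrable_exp_dual μ L measurable_id
    simp only [id] at this
    rw [integral_sub this (integrable_const _), charFunDual_apply]
    simp
  rw [h1, ← integral_const_mul]
  refine norm_integral_le_of_norm_le (hμ.const_mul _) (ae_of_all _ fun y => ?_)
  rw [mul_comm]
  exact (Real.norm_exp_I_mul_ofReal_sub_one_le).trans (L.le_opNorm y)

/-- A law on `E` with a first moment satisfying the distributional equation `Y = a + r Y` is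
unique if `E |r| < 1`. -/
theorem eq_of_perpetuity [BorelSpace E] [SecondCountableTopology E] [CompleteSpace E] (ha : Measurable a) (hr : Measurable r)
    (hri : Integrable r κ) (hr1 : ∫ s, |r s| ∂κ < 1) {μ₁ μ₂ : Measure E}
    [IsProbabilityMeasure μ₁] [IsProbabilityMeasure μ₂]
    (hi₁ : Integrable (fun y => ‖y‖) μ₁) (hi₂ : Integrable (fun y => ‖y‖) μ₂)
    (h₁ : (κ.prod μ₁).map (fun p => a p.1 + r p.1 • p.2) = μ₁)
    (h₂ : (κ.prod μ₂).map (fun p => a p.1 + r p.1 • p.2) = μ₂) : μ₁ = μ₂ := by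
  set c := ∫ s, |r s| ∂κ with hc
  set M := (∫ y, ‖y‖ ∂μ₁) + ∫ y, ‖y‖ ∂μ₂ with hM
  have hint : ∀ (μ : Measure E) [IsProbabilityMeasure μ] (L : StrongDual ℝ E), Integrable
      (fun s => Complex.exp (L (a s) * Complex.I) * charFunDual μ (r s • L)) κ := by
    intro μ _ L
    simpa only [integral_exp_add_smul] using
      (integrable_perpetuity (κ := κ) ha hr μ L).integral_prod_left
  -- Each use of the equation replaces `L` by `r s • L`; since the bound is linear in `‖L‖`,
  -- averaging over `s` gains a factor `c = E |r| < 1`.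
  have key : ∀ (n : ℕ) (L : StrongDual ℝ E),
      ‖charFunDual μ₁ L - charFunDual μ₂ L‖ ≤ c ^ n * (‖L‖ * M) := by
    intro n
    induction n with
    | zero =>
      intro L
      calc ‖charFunDual μ₁ L - charFunDual μ₂ L‖
          = ‖(charFunDual μ₁ L - 1) - (charFunDual μ₂ L - 1)‖ := by congr 1; ring
        _ ≤ ‖charFunDual μ₁ L - 1‖ + ‖charFunDual μ₂ L - 1‖ := norm_sub_le _ _
        _ ≤ _ := by
          rw [pow_zero, one_mul, hM, mul_add]
          exact add_le_add (norm_charFunDual_sub_one_le hi₁ L)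
            (norm_charFunDual_sub_one_le hi₂ L)
    | succ n ih =>
      intro L
      rw [charFunDual_perpetuity ha hr h₁, charFunDual_perpetuity ha hr h₂,
        ← integral_sub (hint μ₁ L) (hint μ₂ L)]
      have : c ^ (n + 1) * (‖L‖ * M) = ∫ s, |r s| * (c ^ n * (‖L‖ * M)) ∂κ := by
        rw [integral_mul_const, ← hc]
        ring
      rw [this]
      refine norm_integral_le_of_norm_le (hri.abs.mul_const _) (ae_of_all _ fun s => ?_)
      rw [← mul_sub, norm_mul, Complex.norm_exp_ofReal_mul_I, one_mul]
      refine (ih (r s • L)).trans (le_of_eq ?_)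
      rw [norm_smul, Real.norm_eq_abs]
      ring
  refine Measure.ext_of_charFunDual (funext fun L => ?_)
  have hc0 : 0 ≤ c := integral_nonneg fun s => abs_nonneg _
  have hlim : Tendsto (fun n : ℕ => c ^ n * (‖L‖ * M)) atTop (𝓝 (0 * (‖L‖ * M))) :=
    (tendsto_pow_atTop_nhds_zero_of_lt_one hc0 hr1).mul_const _
  rw [zero_mul] at hlim
  have := ge_of_tendsto' hlim fun n => key n L
  exact sub_eq_zero.1 (norm_le_zero_iff.1 this)

end Perpetuity

/-! ### Infinite products of a single probability measure over `ℕ` -/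

/-- The sequence `p, ω 0, ω 1, …`. -/
def seqCons {α : Type*} (p : α) (ω : ℕ → α) : ℕ → α
  | 0 => p
  | n + 1 => ω n

@[fun_prop]
lemma measurable_seqCons {α : Type*} [MeasurableSpace α] :
    Measurable fun q : α × (ℕ → α) => seqCons q.1 q.2 := by
  refine measurable_pi_lambda _ fun n => ?_
  cases n with
  | zero => exact measurable_fst
  | succ n => exact (measurable_pi_apply n).comp measurable_snd

/-- Prepending an independent draw to an i.i.d. sequence preserves its law. This is the source of
the self-similarity of stick breaking. -/
lemma map_seqCons_prod_infinitePi {α : Type*} [MeasurableSpace α] (ρ : Measure α)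
    [IsProbabilityMeasure ρ] :
    (ρ.prod (Measure.infinitePi fun _ : ℕ => ρ)).map (fun q => seqCons q.1 q.2) =
      Measure.infinitePi fun _ : ℕ => ρ := by
  classical
  refine Measure.eq_infinitePi _ fun s t ht => ?_
  -- Padding with `univ` turns the cylinder over `s` into one over an initial segment, from which
  -- coordinate `0` splits off.
  set t' : ℕ → Set α := fun i => if i ∈ s then t i else univ with ht'
  have hm : ∀ i, MeasurableSet (t' i) := fun i => by
    simp only [ht']; split_ifs <;> [exact ht i; exact MeasurableSet.univ]
  obtain ⟨N, hN⟩ : ∃ N, s ⊆ Finset.range (N + 1) :=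
    ⟨s.sup id, fun i hi => Finset.mem_range.2 (Nat.lt_succ_of_le (Finset.le_sup (f := id) hi))⟩
  have hpre : (fun q : α × (ℕ → α) => seqCons q.1 q.2) ⁻¹' (Set.pi s t) =
      t' 0 ×ˢ Set.pi (Finset.range N) fun i => t' (i + 1) := by
    ext ⟨p, ω⟩
    simp only [mem_preimage, Set.mem_pi, Finset.mem_coe, mem_prod, Finset.mem_range]
    constructor
    · intro h
      refine ⟨?_, fun i _ => ?_⟩
      · simp only [ht']; split_ifs with h0 <;> [exact h 0 h0; trivial]
      · simp only [ht']; split_ifs with h0 <;> [exact h (i + 1) h0; trivial]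
    · rintro ⟨h0, h1⟩ i hi
      have hiN := Finset.mem_range.1 (hN hi)
      cases i with
      | zero => simpa [ht', hi, seqCons] using h0
      | succ i => simpa [ht', hi, seqCons] using h1 i (by omega)
  have hprod : ∏ i ∈ s, ρ (t i) = ∏ i ∈ Finset.range (N + 1), ρ (t' i) := by
    rw [← Finset.prod_subset hN]
    · exact Finset.prod_congr rfl fun i hi => by simp [ht', hi]
    · intro i _ hi
      simp [ht', hi]
  rw [Measure.map_apply measurable_seqCons (.pi s.countable_toSet fun i _ => ht i), hpre,
    Measure.prod_prod, Measure.infinitePi_pi _ fun i _ => hm _, hprod, Finset.prod_range_succ',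
    mul_comm]

lemma ae_infinitePi_of_ae {α : Type*} [MeasurableSpace α] {ρ : Measure α}
    [IsProbabilityMeasure ρ] {P : α → Prop} (h : ∀ᵐ p ∂ρ, P p) :
    ∀ᵐ ω ∂Measure.infinitePi fun _ : ℕ => ρ, ∀ k, P (ω k) :=
  ae_all_iff.2 fun k =>
    (measurePreserving_eval_infinitePi (fun _ : ℕ => ρ) k).quasiMeasurePreserving.ae h

/-! ### Stick breaking -/

section StickBreaking

variable {X : Type*}

/-- The length of the `k`-th piece obtained by breaking successively the proportions `(ω k).1`
off a stick of length one. -/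
def stickWeight (ω : ℕ → ℝ × X) (k : ℕ) : ℝ≥0∞ :=
  ENNReal.ofReal (ω k).1 * ∏ j ∈ Finset.range k, ENNReal.ofReal (1 - (ω j).1)

lemma sum_stickWeight_add {ω : ℕ → ℝ × X} (hω : ∀ k, (ω k).1 ∈ Ioo (0 : ℝ) 1) (n : ℕ) :
    ∑ k ∈ Finset.range n, stickWeight ω k +
      ∏ j ∈ Finset.range n, ENNReal.ofReal (1 - (ω j).1) = 1 := by
  induction n with
  | zero => simp
  | succ n ih =>
    rw [Finset.sum_range_succ, Finset.prod_range_succ, add_assoc, stickWeight, mul_comm,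
      ← mul_add, ← ENNReal.ofReal_add (hω n).1.le (by linarith [(hω n).2])]
    simpa using ih

variable [MeasurableSpace X]

/-- The measure with atoms at the points `(ω k).2` whose masses are the lengths of the pieces of a
stick broken at the successive proportions `(ω k).1`. -/
def stickMeasure (ω : ℕ → ℝ × X) : Measure X :=
  Measure.sum fun k => stickWeight ω k • Measure.dirac (ω k).2

lemma stickMeasure_apply (ω : ℕ → ℝ × X) {s : Set X} (hs : MeasurableSet s) :
    stickMeasure ω s = ∑' k, stickWeight ω k * s.indicator 1 (ω k).2 := by
  simp [stickMeasure, Measure.sum_apply _ hs, Measure.dirac_apply' _ hs]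

@[fun_prop]
lemma measurable_stickMeasure : Measurable (stickMeasure (X := X)) := by
  refine Measure.measurable_of_measurable_coe _ fun s hs => ?_
  simp only [stickMeasure_apply _ hs, stickWeight]
  refine Measurable.tsum fun k => Measurable.mul (by fun_prop) ?_
  exact (measurable_one.indicator hs).comp (by fun_prop)

lemma stickMeasure_seqCons (p : ℝ × X) (ω : ℕ → ℝ × X) :
    stickMeasure (seqCons p ω) =
      ENNReal.ofReal p.1 • Measure.dirac p.2 + ENNReal.ofReal (1 - p.1) • stickMeasure ω := by
  ext s hs
  simp only [Measure.add_apply, Measure.smul_apply, stickMeasure_apply _ hs, smul_eq_mul,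
    Measure.dirac_apply' _ hs]
  rw [tsum_eq_zero_add' ENNReal.summable, ← ENNReal.tsum_mul_left]
  congr 1
  · simp [stickWeight, seqCons]
  · refine tsum_congr fun k => ?_
    simp only [stickWeight, seqCons, Finset.prod_range_succ']
    ring

lemma stickMeasure_univ_le_one {ω : ℕ → ℝ × X} (hω : ∀ k, (ω k).1 ∈ Ioo (0 : ℝ) 1) :
    stickMeasure ω univ ≤ 1 := by
  rw [stickMeasure_apply _ MeasurableSet.univ]
  simp only [indicator_univ, Pi.one_apply, mul_one]
  exact ENNReal.tsum_le_of_sum_range_le fun n =>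
    le_self_add.trans (sum_stickWeight_add hω n).le

variable {τ : Measure ℝ} {σ : Measure X}

lemma ae_prod_fst_mem_Ioo (hτ : ∀ᵐ v ∂τ, v ∈ Ioo (0 : ℝ) 1) :
    ∀ᵐ p ∂τ.prod σ, p.1 ∈ Ioo (0 : ℝ) 1 :=
  Measure.quasiMeasurePreserving_fst.ae hτ

variable [IsProbabilityMeasure τ] [IsProbabilityMeasure σ]

/-- By self-similarity the mean total mass `m` satisfies `m = a + b m`, where `a = E v > 0` and `a +
b = 1`; hence `m = 1`. A mass that is at most `1` with mean `1` equals `1` almost surely. -/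
lemma ae_isProbabilityMeasure_stickMeasure (hτ : ∀ᵐ v ∂τ, v ∈ Ioo (0 : ℝ) 1) :
    ∀ᵐ ω ∂Measure.infinitePi fun _ : ℕ => τ.prod σ, IsProbabilityMeasure (stickMeasure ω) := by
  set Q := Measure.infinitePi fun _ : ℕ => τ.prod σ with hQ
  have hmu : Measurable fun ω : ℕ → ℝ × X => stickMeasure ω univ :=
    (Measure.measurable_coe MeasurableSet.univ).comp measurable_stickMeasure
  have hle : ∀ᵐ ω ∂Q, stickMeasure ω univ ≤ 1 := by
    filter_upwards [ae_infinitePi_of_ae (ae_prod_fst_mem_Ioo (σ := σ) hτ)] with ω hω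
    exact stickMeasure_univ_le_one hω
  set m := ∫⁻ ω, stickMeasure ω univ ∂Q with hm
  set a := ∫⁻ v, ENNReal.ofReal v ∂τ with ha
  set b := ∫⁻ v, ENNReal.ofReal (1 - v) ∂τ with hb
  have hm1 : m ≤ 1 := (lintegral_mono_ae hle).trans (by simp)
  have hab : a + b = 1 := by
    rw [ha, hb, ← lintegral_add_left (by fun_prop)]
    have : ∀ᵐ v ∂τ, ENNReal.ofReal v + ENNReal.ofReal (1 - v) = 1 := by
      filter_upwards [hτ] with v hv
      rw [← ENNReal.ofReal_add hv.1.le (by linarith [hv.2])]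
      simp
    rw [lintegral_congr_ae this]
    simp
  have ha0 : a ≠ 0 := by
    intro h
    rw [ha, lintegral_eq_zero_iff (by fun_prop)] at h
    obtain ⟨v, hv, hv'⟩ := (hτ.and h).exists
    simp only [Pi.zero_apply, ENNReal.ofReal_eq_zero] at hv'
    exact absurd hv.1 (not_lt.2 hv')
  have hrec : m = a + b * m := by
    have h1 : m = ∫⁻ q, stickMeasure (seqCons q.1 q.2) univ ∂(τ.prod σ).prod Q := by
      rw [hm]
      conv_lhs => rw [hQ, ← map_seqCons_prod_infinitePi (τ.prod σ)]
      rw [lintegral_map hmu (by fun_prop)]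
    have h2 : ∀ q : (ℝ × X) × (ℕ → ℝ × X), stickMeasure (seqCons q.1 q.2) univ =
        ENNReal.ofReal q.1.1 + ENNReal.ofReal (1 - q.1.1) * stickMeasure q.2 univ := by
      intro q
      simp [stickMeasure_seqCons]
    simp only [h2] at h1
    refine h1.trans ?_
    rw [lintegral_add_left (by fun_prop),
      lintegral_prod_mul (f := fun p : ℝ × X => ENNReal.ofReal (1 - p.1))
        (g := fun ω => stickMeasure ω univ) (by fun_prop) hmu.aemeasurable,
      lintegral_prod _ (by fun_prop), lintegral_prod _ (by fun_prop),
      lintegral_prod _ (by fun_prop)]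
    simp [ha, hb, hm]
  have hm_eq : m = 1 := by
    have hat : a ≠ ∞ := ne_top_of_le_ne_top ENNReal.one_ne_top (hab ▸ le_self_add)
    have hbt : b * m ≠ ∞ := ne_top_of_le_ne_top ENNReal.one_ne_top
      ((le_add_self.trans hrec.ge).trans hm1)
    have h3 : a * m + b * m = a * 1 + b * m := by rw [← add_mul, hab, one_mul, mul_one, ← hrec]
    exact (ENNReal.mul_right_inj ha0 hat).1 ((ENNReal.add_left_inj hbt).1 h3)
  have := ae_eq_of_ae_le_of_lintegral_le (g := fun _ => 1) hle
    (ne_top_of_le_ne_top ENNReal.one_ne_top hm1) aemeasurable_const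
    (by rw [← hm, hm_eq]; simp)
  filter_upwards [this] with ω hω
  exact ⟨hω⟩

/-- The law of the random probability measure obtained by stick breaking with proportions of law
`τ` and atoms of law `σ`. -/
def stickLaw (τ : Measure ℝ) (σ : Measure X) : Measure (ProbabilityMeasure X) :=
  ((Measure.infinitePi fun _ : ℕ => τ.prod σ).map stickMeasure).comap
    fun η : ProbabilityMeasure X => (η : Measure X)

lemma measurableEmbedding_coe_probabilityMeasure :
    MeasurableEmbedding fun η : ProbabilityMeasure X => (η : Measure X) :=
  MeasurableEmbedding.subtype_coe ProbabilityMeasure.measurableSet_isProbabilityMeasure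

/-- The `comap` in `stickLaw` loses no mass, because the random measure is almost surely a
probability. -/
lemma map_coe_stickLaw (hτ : ∀ᵐ v ∂τ, v ∈ Ioo (0 : ℝ) 1) :
    (stickLaw τ σ).map (fun η : ProbabilityMeasure X => (η : Measure X)) =
      (Measure.infinitePi fun _ : ℕ => τ.prod σ).map stickMeasure := by
  rw [stickLaw, measurableEmbedding_coe_probabilityMeasure.map_comap]
  refine Measure.restrict_eq_self_of_ae_mem ?_
  refine (ae_map_iff (by fun_prop)
    measurableEmbedding_coe_probabilityMeasure.measurableSet_range).2 ?_
  filter_upwards [ae_isProbabilityMeasure_stickMeasure (σ := σ) hτ] with ω hω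
  exact ⟨⟨_, hω⟩, rfl⟩

lemma map_comp_coe_stickLaw (hτ : ∀ᵐ v ∂τ, v ∈ Ioo (0 : ℝ) 1) {F : Type*} [MeasurableSpace F]
    {φ : Measure X → F} (hφ : Measurable φ) :
    (stickLaw τ σ).map (fun η : ProbabilityMeasure X => φ (η : Measure X)) =
      (Measure.infinitePi fun _ : ℕ => τ.prod σ).map fun ω => φ (stickMeasure ω) := by
  have h := congrArg (Measure.map φ) (map_coe_stickLaw (σ := σ) hτ)
  rwa [Measure.map_map hφ measurableEmbedding_coe_probabilityMeasure.measurable,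
    Measure.map_map hφ measurable_stickMeasure] at h

lemma isProbabilityMeasure_stickLaw (hτ : ∀ᵐ v ∂τ, v ∈ Ioo (0 : ℝ) 1) :
    IsProbabilityMeasure (stickLaw τ σ) := by
  have := Measure.isProbabilityMeasure_map (μ := Measure.infinitePi fun _ : ℕ => τ.prod σ)
    (measurable_stickMeasure (X := X)).aemeasurable
  rw [← map_coe_stickLaw hτ] at this
  exact Measure.isProbabilityMeasure_of_map
    (f := fun η : ProbabilityMeasure X => (η : Measure X))

lemma ae_stickLaw_apply_eq_zero (hτ : ∀ᵐ v ∂τ, v ∈ Ioo (0 : ℝ) 1) {N : Set X}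
    (hN : MeasurableSet N) (h0 : σ N = 0) :
    ∀ᵐ η : ProbabilityMeasure X ∂stickLaw τ σ, (η : Measure X) N = 0 := by
  have hm : MeasurableSet {μ : Measure X | μ N = 0} :=
    Measure.measurable_coe hN (measurableSet_singleton 0)
  have key : ∀ᵐ μ ∂(stickLaw τ σ).map (fun η : ProbabilityMeasure X => (η : Measure X)),
      μ N = 0 := by
    rw [map_coe_stickLaw hτ, ae_map_iff (by fun_prop) hm]
    have : ∀ᵐ p ∂τ.prod σ, p.2 ∉ N :=
      Measure.quasiMeasurePreserving_snd.ae (measure_eq_zero_iff_ae_notMem.1 h0)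
    filter_upwards [ae_infinitePi_of_ae this] with ω hω
    simp [stickMeasure_apply _ hN, hω]
  exact (ae_map_iff measurableEmbedding_coe_probabilityMeasure.measurable.aemeasurable hm).1 key

end StickBreaking

/-! ### Existence of the Dirichlet–Ferguson measure -/

section Existence

variable {X : Type*}

/-- The vector of the indicators at `x` of the sets `A i`. -/
def cellIndicator {k : ℕ} (A : Fin k → Set X) (x : X) : Fin k → ℝ :=
  fun i => (A i).indicator 1 x

/-- The vector of the masses of the sets `A i`. -/
def cellMass [MeasurableSpace X] {k : ℕ} (A : Fin k → Set X) (μ : Measure X) : Fin k → ℝ :=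
  fun i => μ.real (A i)

variable [MeasurableSpace X] {k : ℕ} {A : Fin k → Set X} {ν : Measure X}

lemma measurable_cellIndicator (hA : ∀ i, MeasurableSet (A i)) :
    Measurable (cellIndicator A) :=
  measurable_pi_lambda _ fun i => measurable_one.indicator (hA i)

lemma measurable_cellMass (hA : ∀ i, MeasurableSet (A i)) : Measurable (cellMass A) :=
  measurable_pi_lambda _ fun i => (Measure.measurable_coe (hA i)).ennreal_toReal

lemma IsNontrivialPartition.cellIndicator_eq (h : IsNontrivialPartition ν A) {j : Fin k} {x : X}
    (hx : x ∈ A j) : cellIndicator A x = Pi.single j 1 := by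
  ext i
  by_cases hij : i = j
  · subst hij
    simp [cellIndicator, hx]
  · have : x ∉ A i := fun hxi => (h.disjoint i j hij).le_bot ⟨hxi, hx⟩
    simp [cellIndicator, this, hij]

lemma IsNontrivialPartition.lintegral_cellIndicator (h : IsNontrivialPartition ν A)
    (σ : Measure X) (g : (Fin k → ℝ) → ℝ≥0∞) :
    ∫⁻ x, g (cellIndicator A x) ∂σ = ∑ j, σ (A j) * g (Pi.single j 1) := by
  rw [← setLIntegral_univ, ← h.iUnion_eq, lintegral_iUnion h.measurableSet
    (fun i j hij => h.disjoint i j hij), tsum_fintype]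
  refine Finset.sum_congr rfl fun j _ => ?_
  rw [setLIntegral_congr_fun (g := fun _ => g (Pi.single j 1)) (h.measurableSet j)
    fun x hx => by rw [h.cellIndicator_eq hx], setLIntegral_const, mul_comm]

lemma IsNontrivialPartition.sum_measureReal [IsFiniteMeasure ν]
    (h : IsNontrivialPartition ν A) : ∑ i, ν.real (A i) = ν.real univ := by
  rw [measureReal_def, ← h.iUnion_eq, measure_iUnion (fun i j hij => h.disjoint i j hij)
    h.measurableSet, tsum_fintype, ENNReal.toReal_sum fun i _ => measure_ne_top _ _]
  rfl

lemma IsNontrivialPartition.measureReal_pos [IsFiniteMeasure ν]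
    (h : IsNontrivialPartition ν A) (i : Fin k) : 0 < ν.real (A i) :=
  ENNReal.toReal_pos (h.pos i).ne' (measure_ne_top _ _)

/-- The Dirichlet distribution is invariant under breaking a proportion of law `Beta(1, ν X)` off
the unit mass and giving it to the cell of a point of law `ν / ν X`. -/
lemma IsNontrivialPartition.map_dirichlet {n : ℕ} {A : Fin (n + 1) → Set X} [IsFiniteMeasure ν]
    (h : IsNontrivialPartition ν A) :
    (((betaMeasure 1 (ν.real univ)).prod ((ν univ)⁻¹ • ν)).prod
      (dirichlet fun i => ν.real (A i))).map
        (fun p => p.1.1 • cellIndicator A p.1.2 + (1 - p.1.1) • p.2) =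
      dirichlet fun i => ν.real (A i) := by
  set α : Fin (n + 1) → ℝ := fun i => ν.real (A i) with hα
  have hpos : ∀ i, 0 < α i := h.measureReal_pos
  have hsum : ∑ i, α i = ν.real univ := h.sum_measureReal
  have hβ : 0 < ν.real univ := hsum ▸ Finset.sum_pos (fun i _ => hpos i) Finset.univ_nonempty
  have := isProbabilityMeasure_dirichlet hpos
  have := isProbabilityMeasureBeta one_pos hβ
  have hν : ν univ ≠ 0 := fun h0 => by simp [measureReal_def, h0] at hβ
  have hσ : ∀ j, ((ν univ)⁻¹ • ν) (A j) = ENNReal.ofReal (α j / ν.real univ) := by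
    intro j
    rw [ENNReal.ofReal_div_of_pos hβ, hα, ofReal_measureReal, ofReal_measureReal,
      Measure.smul_apply, smul_eq_mul, ENNReal.div_eq_inv_mul]
  have : IsFiniteMeasure ((ν univ)⁻¹ • ν) := by
    constructor
    simp [ENNReal.inv_mul_cancel hν (measure_ne_top _ _)]
  have hc := measurable_cellIndicator h.measurableSet
  refine Measure.ext_of_lintegral _ fun g hg => ?_
  have hG : Measurable fun p : (ℝ × (Fin (n + 1) → ℝ)) × (Fin (n + 1) → ℝ) =>
      g (p.1.1 • p.1.2 + (1 - p.1.1) • p.2) := by fun_prop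
  have hG' : Measurable fun p : ℝ × (Fin (n + 1) → ℝ) =>
      ∫⁻ y, g (p.1 • p.2 + (1 - p.1) • y) ∂dirichlet α := hG.lintegral_prod_right'
  have hG'' : Measurable fun p : ℝ × X =>
      ∫⁻ y, g (p.1 • cellIndicator A p.2 + (1 - p.1) • y) ∂dirichlet α :=
    hG'.comp (by fun_prop : Measurable fun p : ℝ × X => (p.1, cellIndicator A p.2))
  have hcell : ∀ v : ℝ, ∫⁻ x, ∫⁻ y, g (v • cellIndicator A x + (1 - v) • y) ∂dirichlet α
      ∂((ν univ)⁻¹ • ν) = ∑ j, ENNReal.ofReal (α j / ν.real univ) *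
        ∫⁻ y, g (v • Pi.single j 1 + (1 - v) • y) ∂dirichlet α := by
    intro v
    simp only [← hσ]
    exact h.lintegral_cellIndicator _ fun e => ∫⁻ y, g (v • e + (1 - v) • y) ∂dirichlet α
  rw [lintegral_map hg (by fun_prop), lintegral_prod _ (by fun_prop),
    lintegral_prod _ hG''.aemeasurable]
  simp only [hcell]
  have hm : ∀ j, Measurable fun v : ℝ => ∫⁻ y,
      g (v • Pi.single j 1 + (1 - v) • y) ∂dirichlet α :=
    fun j => hG'.comp (by fun_prop :
      Measurable fun v : ℝ => (v, (Pi.single j 1 : Fin (n + 1) → ℝ)))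
  rw [lintegral_finsetSum _ fun j _ => (hm j).const_mul _]
  simp only [lintegral_const_mul _ (hm _)]
  rw [← hsum]
  exact sum_lintegral_dirichlet_stick hpos hg

/-- The stick-breaking counterpart of `IsNontrivialPartition.map_dirichlet`: evaluate
`stickMeasure_seqCons` on the cells and use invariance under prepending a draw. -/
lemma IsNontrivialPartition.map_stickMeasure (h : IsNontrivialPartition ν A)
    {τ : Measure ℝ} [IsProbabilityMeasure τ] {σ : Measure X} [IsProbabilityMeasure σ]
    (hτ : ∀ᵐ v ∂τ, v ∈ Ioo (0 : ℝ) 1) :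
    ((τ.prod σ).prod ((Measure.infinitePi fun _ : ℕ => τ.prod σ).map
      fun ω => cellMass A (stickMeasure ω))).map
        (fun p => p.1.1 • cellIndicator A p.1.2 + (1 - p.1.1) • p.2) =
      (Measure.infinitePi fun _ : ℕ => τ.prod σ).map fun ω => cellMass A (stickMeasure ω) := by
  have hc := measurable_cellIndicator h.measurableSet
  have hW : Measurable fun ω : ℕ → ℝ × X => cellMass A (stickMeasure ω) :=
    (measurable_cellMass h.measurableSet).comp measurable_stickMeasure
  set Q := Measure.infinitePi fun _ : ℕ => τ.prod σ with hQ
  have h1 : (τ.prod σ).prod (Q.map fun ω => cellMass A (stickMeasure ω)) =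
      ((τ.prod σ).prod Q).map (Prod.map id fun ω => cellMass A (stickMeasure ω)) := by
    rw [← Measure.map_prod_map _ _ measurable_id hW, Measure.map_id]
  rw [h1, Measure.map_map (by fun_prop) (by fun_prop)]
  conv_rhs => rw [hQ, ← map_seqCons_prod_infinitePi (τ.prod σ),
    Measure.map_map hW measurable_seqCons]
  refine Measure.map_congr ?_
  have hv : ∀ᵐ q ∂(τ.prod σ).prod Q, q.1.1 ∈ Ioo (0 : ℝ) 1 :=
    Measure.quasiMeasurePreserving_fst.ae (ae_prod_fst_mem_Ioo hτ)
  have hp : ∀ᵐ q ∂(τ.prod σ).prod Q, IsProbabilityMeasure (stickMeasure q.2) :=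
    Measure.quasiMeasurePreserving_snd.ae (ae_isProbabilityMeasure_stickMeasure hτ)
  filter_upwards [hv, hp] with q hq hq'
  ext i
  have hi := h.measurableSet i
  simp only [Function.comp_apply, Prod.map_fst, Prod.map_snd, id, Pi.add_apply, Pi.smul_apply,
    smul_eq_mul, cellMass, cellIndicator, stickMeasure_seqCons, measureReal_def,
    Measure.add_apply, Measure.smul_apply, Measure.dirac_apply' _ hi]
  rw [ENNReal.toReal_add, ENNReal.toReal_mul, ENNReal.toReal_mul,
    ENNReal.toReal_ofReal hq.1.le, ENNReal.toReal_ofReal (by linarith [hq.2])]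
  · congr 2
    by_cases hx : q.1.2 ∈ A i <;> simp [hx]
  · by_cases hx : q.1.2 ∈ A i <;> simp [hx]
  · exact ENNReal.mul_ne_top ENNReal.ofReal_ne_top (measure_ne_top _ _)

lemma integral_abs_lt_one {S : Type*} [MeasurableSpace S] {κ : Measure S}
    [IsProbabilityMeasure κ] {r : S → ℝ} (hr : Integrable r κ)
    (h : ∀ᵐ s ∂κ, r s ∈ Ioo (0 : ℝ) 1) : ∫ s, |r s| ∂κ < 1 := by
  have h0 : 0 ≤ᵐ[κ] fun s => 1 - |r s| := by
    filter_upwards [h] with s hs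
    simp [abs_of_pos hs.1, hs.2.le]
  have hpos : 0 < ∫ s, (1 - |r s|) ∂κ := by
    rw [integral_pos_iff_support_of_nonneg_ae h0 ((integrable_const _).sub hr.abs),
      pos_iff_ne_zero]
    intro hz
    obtain ⟨s, hs, hs'⟩ := (h.and (measure_eq_zero_iff_ae_notMem.1 hz)).exists
    simp only [Function.mem_support, not_not, abs_of_pos hs.1] at hs'
    linarith [hs.2]
  rw [integral_sub (integrable_const _) hr.abs] at hpos
  simp only [integral_const, probReal_univ, smul_eq_mul, mul_one] at hpos
  linarith

lemma integrable_norm_of_ae_mem_Icc {μ : Measure (Fin k → ℝ)} [IsProbabilityMeasure μ]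
    (h : ∀ᵐ y ∂μ, ∀ i, y i ∈ Icc (0 : ℝ) 1) : Integrable (fun y => ‖y‖) μ := by
  refine Integrable.of_bound (C := 1) (by fun_prop) ?_
  filter_upwards [h] with y hy
  rw [norm_norm, pi_norm_le_iff_of_nonneg zero_le_one]
  intro i
  rw [Real.norm_eq_abs, abs_of_nonneg (hy i).1]
  exact (hy i).2

lemma ae_betaMeasure_mem_Ioo (a b : ℝ) : ∀ᵐ v ∂betaMeasure a b, v ∈ Ioo (0 : ℝ) 1 := by
  have hm : Measurable (betaPDF a b) := by unfold betaPDF; fun_prop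
  rw [betaMeasure, ae_withDensity_iff hm]
  refine ae_of_all _ fun v hv => ⟨not_le.1 fun h => hv (betaPDF_eq_zero_of_nonpos h),
    not_le.1 fun h => hv (betaPDF_eq_zero_of_one_le h)⟩

lemma IsNontrivialPartition.map_cellMass_stickMeasure {n : ℕ} {A : Fin (n + 1) → Set X}
    [IsFiniteMeasure ν] (h : IsNontrivialPartition ν A) :
    (Measure.infinitePi fun _ : ℕ => (betaMeasure 1 (ν.real univ)).prod ((ν univ)⁻¹ • ν)).map
      (fun ω => cellMass A (stickMeasure ω)) = dirichlet fun i => ν.real (A i) := by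
  have hpos : ∀ i, 0 < ν.real (A i) := h.measureReal_pos
  have hβ : 0 < ν.real univ := h.sum_measureReal ▸
    Finset.sum_pos (fun i _ => hpos i) Finset.univ_nonempty
  have hν : ν ≠ 0 := fun h0 => by simp [h0] at hβ
  have : NeZero ν := ⟨hν⟩
  have hσ : IsProbabilityMeasure ((ν univ)⁻¹ • ν) := inferInstance
  have hτp := isProbabilityMeasureBeta one_pos hβ
  have hτ := ae_betaMeasure_mem_Ioo 1 (ν.real univ)
  have := isProbabilityMeasure_dirichlet hpos
  have hc := measurable_cellIndicator h.measurableSet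
  have hW : Measurable fun ω : ℕ → ℝ × X => cellMass A (stickMeasure ω) :=
    (measurable_cellMass h.measurableSet).comp measurable_stickMeasure
  have := Measure.isProbabilityMeasure_map (μ := Measure.infinitePi fun _ : ℕ =>
    (betaMeasure 1 (ν.real univ)).prod ((ν univ)⁻¹ • ν)) hW.aemeasurable
  have hr : ∀ᵐ p ∂(betaMeasure 1 (ν.real univ)).prod ((ν univ)⁻¹ • ν),
      1 - p.1 ∈ Ioo (0 : ℝ) 1 := by
    filter_upwards [ae_prod_fst_mem_Ioo hτ] with p hp
    exact ⟨by linarith [hp.2], by linarith [hp.1]⟩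
  have hri : Integrable (fun p : ℝ × X => 1 - p.1)
      ((betaMeasure 1 (ν.real univ)).prod ((ν univ)⁻¹ • ν)) := by
    refine Integrable.of_bound (C := 1) (by fun_prop) ?_
    filter_upwards [hr] with p hp
    rw [Real.norm_eq_abs, abs_of_pos hp.1]
    exact hp.2.le
  refine eq_of_perpetuity (κ := (betaMeasure 1 (ν.real univ)).prod ((ν univ)⁻¹ • ν))
    (a := fun p => p.1 • cellIndicator A p.2) (r := fun p => 1 - p.1) (by fun_prop)
    (by fun_prop) hri (integral_abs_lt_one hri hr) (integrable_norm_of_ae_mem_Icc ?_)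
    (integrable_norm_of_ae_mem_Icc (ae_dirichlet_mem _)) (h.map_stickMeasure hτ) h.map_dirichlet
  have hm : MeasurableSet {y : Fin (n + 1) → ℝ | ∀ i, y i ∈ Icc (0 : ℝ) 1} := by
    simp only [ofPred_forall]
    exact MeasurableSet.iInter fun i => measurable_pi_apply i measurableSet_Icc
  rw [ae_map_iff hW.aemeasurable hm]
  filter_upwards [ae_isProbabilityMeasure_stickMeasure hτ] with ω hω i
  exact ⟨measureReal_nonneg, measureReal_le_one⟩

theorem isDirichletFerguson_stickLaw [IsFiniteMeasure ν] (hν : ν ≠ 0) :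
    IsDirichletFerguson ν (stickLaw (betaMeasure 1 (ν.real univ)) ((ν univ)⁻¹ • ν)) := by
  have : NeZero ν := ⟨hν⟩
  have hβ : 0 < ν.real univ := measureReal_univ_pos
  have hτp := isProbabilityMeasureBeta one_pos hβ
  have hτ := ae_betaMeasure_mem_Ioo 1 (ν.real univ)
  refine ⟨isProbabilityMeasure_stickLaw hτ, fun n A hA => ?_, fun N hN h0 => ?_⟩
  · rw [← hA.map_cellMass_stickMeasure]
    exact map_comp_coe_stickLaw hτ (measurable_cellMass hA.measurableSet)
  · exact ae_stickLaw_apply_eq_zero hτ hN (by simp [h0])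

end Existence

/-! ### Uniqueness of the Dirichlet–Ferguson measure -/

section Uniqueness

variable {X : Type*} [MeasurableSpace X] {ν : Measure X} {D D' : Measure (ProbabilityMeasure X)}

@[fun_prop]
lemma measurable_coe_probabilityMeasure :
    Measurable fun η : ProbabilityMeasure X => (η : Measure X) :=
  measurableEmbedding_coe_probabilityMeasure.measurable

lemma measurable_probabilityMeasure_real {s : Set X} (hs : MeasurableSet s) :
    Measurable fun η : ProbabilityMeasure X => (η : Measure X).real s :=
  ((Measure.measurable_coe hs).comp measurable_coe_probabilityMeasure).ennreal_toReal

lemma measurable_evalPartition {k : ℕ} {A : Fin k → Set X} (hA : ∀ i, MeasurableSet (A i)) :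
    Measurable (evalPartition A) :=
  measurable_pi_lambda _ fun i => measurable_probabilityMeasure_real (hA i)

/-- The fibres of `c` form a finite partition, possibly with null cells. Indexing by all `J : Set T`
covers every union of cells, hence also overlapping sets. -/
lemma IsDirichletFerguson.map_preimage_eq (hν : ν ≠ 0) (hD : IsDirichletFerguson ν D)
    (hD' : IsDirichletFerguson ν D') {T : Type*} [Finite T] [MeasurableSpace T]
    [DiscreteMeasurableSpace T] {c : X → T} (hc : Measurable c) :
    D.map (fun (η : ProbabilityMeasure X) (J : Set T) => (η : Measure X).real (c ⁻¹' J)) =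
      D'.map (fun (η : ProbabilityMeasure X) (J : Set T) => (η : Measure X).real (c ⁻¹' J)) := by
  classical
  have hP : ∃ t, 0 < ν (c ⁻¹' {t}) := by
    by_contra! h
    refine hν (Measure.measure_univ_eq_zero.1 ?_)
    have : (univ : Set X) = ⋃ t, c ⁻¹' {t} := by ext; simp
    rw [this, measure_iUnion_null fun t => nonpos_iff_eq_zero.1 (h t)]
  obtain ⟨n, ⟨e⟩⟩ : ∃ n, Nonempty (Fin (n + 1) ≃ {t // 0 < ν (c ⁻¹' {t})}) := by
    obtain ⟨m, ⟨e⟩⟩ := Finite.exists_equiv_fin {t // 0 < ν (c ⁻¹' {t})}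
    cases m with
    | zero => exact (IsEmpty.false (e ⟨_, hP.choose_spec⟩)).elim
    | succ n => exact ⟨n, ⟨e.symm⟩⟩
  -- Labels with null fibre are merged into cell `0`, so that the cells cover `X` and all have
  -- positive mass. The merged part `N` is `ν`-null, hence almost surely `η`-null.
  set g : T → Fin (n + 1) := fun t =>
    if h : 0 < ν (c ⁻¹' {t}) then e.symm ⟨t, h⟩ else 0 with hg
  have hge : ∀ j, g (e j) = j := fun j => by simp [hg, (e j).2]
  have heg : ∀ t, 0 < ν (c ⁻¹' {t}) → (e (g t) : T) = t := fun t ht => by simp [hg, ht]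
  have hgc : Measurable (g ∘ c) := (measurable_of_finite g).comp hc
  set A : Fin (n + 1) → Set X := fun j => (g ∘ c) ⁻¹' {j} with hA
  have hAm : ∀ j, MeasurableSet (A j) := fun j => hgc (measurableSet_singleton j)
  have hpart : IsNontrivialPartition ν A := by
    refine ⟨hAm, fun j => (e j).2.trans_le (measure_mono ?_), fun i j hij => ?_, ?_⟩
    · intro x hx
      simp only [mem_preimage, mem_singleton_iff] at hx
      simp [hA, hx, hge]
    · exact Disjoint.preimage _ (by simpa using hij)
    · ext x
      simp [hA]
  set N : Set X := c ⁻¹' {t | ν (c ⁻¹' {t}) = 0} with hN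
  have hNm : MeasurableSet N := hc (MeasurableSet.of_discrete)
  have hN0 : ν N = 0 := by
    have : N = ⋃ t ∈ {t | ν (c ⁻¹' {t}) = 0}, c ⁻¹' {t} := by ext; simp [hN]
    rw [this, measure_biUnion_null_iff (Set.to_countable _)]
    exact fun t ht => ht
  -- Off `N`, the mass of `c ⁻¹' J` is the sum of the masses of the cells labelled in `J`; so the
  -- joint law is a fixed image of a Dirichlet law.
  set lin : (Fin (n + 1) → ℝ) → Set T → ℝ := fun y J =>
    ∑ j ∈ Finset.univ.filter (fun j => (e j : T) ∈ J), y j with hlin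
  have hlinm : Measurable lin := measurable_pi_lambda _ fun J =>
    Finset.measurable_fun_sum _ fun j _ => measurable_pi_apply j
  have key : ∀ D : Measure (ProbabilityMeasure X), IsDirichletFerguson ν D →
      D.map (fun (η : ProbabilityMeasure X) (J : Set T) => (η : Measure X).real (c ⁻¹' J)) =
        (dirichlet fun i => ν.real (A i)).map lin := by
    intro D hD
    rw [← hD.map_evalPartition n A hpart, Measure.map_map hlinm (measurable_evalPartition hAm)]
    refine Measure.map_congr ?_
    filter_upwards [hD.null N hNm hN0] with η hη
    ext J
    have h1 : (c ⁻¹' J : Set X) =ᵐ[(η : Measure X)] (g ∘ c) ⁻¹' {j | (e j : T) ∈ J} := by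
      filter_upwards [measure_eq_zero_iff_ae_notMem.1 hη] with x hx
      have hx' : 0 < ν (c ⁻¹' {c x}) := pos_iff_ne_zero.2 hx
      refine propext ?_
      change c x ∈ J ↔ (e (g (c x)) : T) ∈ J
      rw [heg _ hx']
    rw [measureReal_congr h1, Function.comp_apply, hlin]
    simp only [evalPartition, hA]
    rw [sum_measureReal_preimage_singleton _ fun j _ => hAm j]
    simp
  rw [key D hD, key D' hD']

/-- Reduces equality of laws to the product space `ℝ ^ {measurable sets}`: every event is the
preimage of a measurable set under the family of all evaluations. -/
lemma measurableSpace_probabilityMeasure_le :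
    (inferInstance : MeasurableSpace (ProbabilityMeasure X)) ≤
      MeasurableSpace.comap (fun (η : ProbabilityMeasure X) (s : {s : Set X // MeasurableSet s}) =>
        (η : Measure X).real s) inferInstance := by
  rintro E ⟨E', hE', rfl⟩
  refine @Measure.measurable_of_measurable_coe _ _ _ (MeasurableSpace.comap
    (fun (η : ProbabilityMeasure X) (s : {s : Set X // MeasurableSet s}) =>
      (η : Measure X).real s) inferInstance)
    (fun η : ProbabilityMeasure X => (η : Measure X)) (fun s hs => ?_) E' hE'
  have h : (fun η : ProbabilityMeasure X => (η : Measure X) s) =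
      (fun y : {s : Set X // MeasurableSet s} → ℝ => ENNReal.ofReal (y ⟨s, hs⟩)) ∘
        fun (η : ProbabilityMeasure X) (s : {s : Set X // MeasurableSet s}) =>
          (η : Measure X).real s := by
    ext η
    simp
  rw [h]
  exact Measurable.comp (by fun_prop) (comap_measurable _)

theorem IsDirichletFerguson.unique (hν : ν ≠ 0) (hD : IsDirichletFerguson ν D)
    (hD' : IsDirichletFerguson ν D') : D = D' := by
  have := hD.isProbabilityMeasure
  have := hD'.isProbabilityMeasure
  set Ψ : ProbabilityMeasure X → {s : Set X // MeasurableSet s} → ℝ :=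
    fun η s => (η : Measure X).real s with hΨ
  have hΨm : Measurable Ψ :=
    measurable_pi_lambda _ fun s => measurable_probabilityMeasure_real s.2
  have hfin : ∀ I : Finset {s : Set X // MeasurableSet s},
      (D.map Ψ).map I.restrict = (D'.map Ψ).map I.restrict := by
    intro I
    -- The membership pattern of `x` in the sets of `I` takes finitely many values, and the set `i`
    -- is the preimage of the patterns `S` with `S i`.
    set c : X → I → Prop := fun x i => x ∈ (i : {s : Set X // MeasurableSet s}).1 with hc
    have hcm : Measurable c := measurable_pi_lambda _ fun i => i.1.2.mem
    have h := congrArg (Measure.map fun (y : Set (I → Prop) → ℝ) (i : I) => y {S | S i})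
      (hD.map_preimage_eq hν hD' hcm)
    have hm : Measurable fun (η : ProbabilityMeasure X) (J : Set (I → Prop)) =>
        (η : Measure X).real (c ⁻¹' J) :=
      measurable_pi_lambda _ fun J => measurable_probabilityMeasure_real (hcm .of_discrete)
    rw [Measure.map_map (by fun_prop) hm, Measure.map_map (by fun_prop) hm] at h
    rw [Measure.map_map (by fun_prop) hΨm, Measure.map_map (by fun_prop) hΨm]
    exact h
  have hmap : D.map Ψ = D'.map Ψ := by
    have := Measure.isProbabilityMeasure_map (μ := D') hΨm.aemeasurable
    -- Both laws are projective limits of the same finite-dimensional marginals.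
    exact IsProjectiveLimit.unique (P := fun I => (D'.map Ψ).map I.restrict) hfin fun I => rfl
  ext E hE
  obtain ⟨E', hE', rfl⟩ := measurableSpace_probabilityMeasure_le E hE
  rw [← Measure.map_apply hΨm hE', hmap, Measure.map_apply hΨm hE']

theorem existsUnique_isDirichletFerguson [IsFiniteMeasure ν] (hν : ν ≠ 0) :
    ∃! D : Measure (ProbabilityMeasure X), IsDirichletFerguson ν D :=
  ⟨_, isDirichletFerguson_stickLaw hν, fun _ hD => hD.unique hν (isDirichletFerguson_stickLaw hν)⟩

lemma isDirichletFerguson_dirichletFerguson [IsFiniteMeasure ν] (hν : ν ≠ 0) :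
    IsDirichletFerguson ν (dirichletFerguson ν) := by
  have h : ∃ D : Measure (ProbabilityMeasure X), IsDirichletFerguson ν D :=
    ⟨_, isDirichletFerguson_stickLaw hν⟩
  rw [dirichletFerguson, dif_pos h]
  exact h.choose_spec

end Uniqueness

/-! ### The mapping theorem -/

section Mapping

variable {X X' : Type*} [MeasurableSpace X] [MeasurableSpace X'] {ν : Measure X} {f : X → X'}

lemma coe_pushforward (hf : Measurable f) (η : ProbabilityMeasure X) :
    (pushforward hf η : Measure X') = (η : Measure X).map f := rfl

lemma measurable_pushforward (hf : Measurable f) : Measurable (pushforward hf) :=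
  ((Measure.measurable_map f hf).comp measurable_coe_probabilityMeasure).subtype_mk

lemma IsNontrivialPartition.preimage (hf : Measurable f) {k : ℕ} {A : Fin k → Set X'}
    (h : IsNontrivialPartition (ν.map f) A) : IsNontrivialPartition ν fun i => f ⁻¹' A i where
  measurableSet i := hf (h.measurableSet i)
  pos i := by simpa [Measure.map_apply hf (h.measurableSet i)] using h.pos i
  disjoint i j hij := (h.disjoint i j hij).preimage f
  iUnion_eq := by rw [← preimage_iUnion, h.iUnion_eq, preimage_univ]

theorem IsDirichletFerguson.map_pushforward (hf : Measurable f)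
    {D : Measure (ProbabilityMeasure X)} (hD : IsDirichletFerguson ν D) :
    IsDirichletFerguson (ν.map f) (D.map (pushforward hf)) := by
  have := hD.isProbabilityMeasure
  have hp := measurable_pushforward hf
  refine ⟨Measure.isProbabilityMeasure_map hp.aemeasurable, fun n A hA => ?_, fun N hN h0 => ?_⟩
  · rw [Measure.map_map (measurable_evalPartition hA.measurableSet) hp]
    have h1 : evalPartition A ∘ pushforward hf = evalPartition fun i => f ⁻¹' A i := by
      ext η i
      simp [evalPartition, coe_pushforward, map_measureReal_apply hf (hA.measurableSet i)]
    rw [h1, hD.map_evalPartition n _ (hA.preimage hf)]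
    simp only [map_measureReal_apply hf (hA.measurableSet _)]
  · have hm : MeasurableSet {η : ProbabilityMeasure X' | (η : Measure X') N = 0} :=
      ((Measure.measurable_coe hN).comp measurable_coe_probabilityMeasure)
        (measurableSet_singleton 0)
    rw [Measure.map_apply hf hN] at h0
    refine (ae_map_iff hp.aemeasurable hm).2 ?_
    filter_upwards [hD.null _ (hf hN) h0] with η hη
    rw [coe_pushforward, Measure.map_apply hf hN, hη]

end Mapping

end DirichletFerguson

end

theorem theoremt
    {X X' : Type*}
    [TopologicalSpace X] [SecondCountableTopology X] [LocallyCompactSpace X] [T2Space X]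
    [MeasurableSpace X] [BorelSpace X]
    [TopologicalSpace X'] [SecondCountableTopology X'] [LocallyCompactSpace X'] [T2Space X']
    [MeasurableSpace X'] [BorelSpace X']
    (ν : Measure X) [IsFiniteMeasure ν] (hν : ν ≠ 0)
    (f : X → X') (hf : Measurable f) :
    (∃! D : Measure (ProbabilityMeasure X), DirichletFerguson.IsDirichletFerguson ν D) ∧
    (∃! D' : Measure (ProbabilityMeasure X'),
      DirichletFerguson.IsDirichletFerguson (ν.map f) D') ∧
    (DirichletFerguson.dirichletFerguson ν).map (DirichletFerguson.pushforward hf) =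
      DirichletFerguson.dirichletFerguson (ν.map f) := by
  have hν' : ν.map f ≠ 0 := (Measure.map_ne_zero_iff hf.aemeasurable).2 hν
  exact ⟨DirichletFerguson.existsUnique_isDirichletFerguson hν,
    DirichletFerguson.existsUnique_isDirichletFerguson hν',
    ((DirichletFerguson.isDirichletFerguson_dirichletFerguson hν).map_pushforward hf).unique hν'
      (DirichletFerguson.isDirichletFerguson_dirichletFerguson hν')⟩
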